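/- Let $E$ be a Fréchet space, that is, a complete metrizable locally convex space over $\mathbb K=\mathbb R$ or $\mathbb C$, with topological dual $E'$. An atomic decomposition of $E$ is a pair of sequences $(x_j')_{j\ge 1}\subset E'$, $(x_j)_{j\ge 1}\subset E$ such that $x=\sum_{j=1}^\infty x_j'(x)\,x_j$ for all $x\in E$, with convergence of the partial sums in $E$. The space $E$ has the bounded approximation property if the identity of $E$ is the pointwise limit of an equicontinuous net of continuous linear operators $E\to E$ of finite rank. Then $E$ admits an atomic decomposition if and only if $E$ is separable and has the bounded approximation property. In particular, a separable Fréchet space admits an atomic decomposition if and only if it has the bounded approximation property. -/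

import Mathlib

open Filter Topology

/-- `(f, x)` is an atomic decomposition of the locally convex space `E`: every `y` in `E` is the
limit in `E` of the partial sums of the series `∑ j, f j y • x j` (summed in the order of `ℕ`). -/
def IsAtomicDecomposition (𝕜 : Type*) {E : Type*} [RCLike 𝕜] [AddCommGroup E] [Module 𝕜 E]
    [TopologicalSpace E] (f : ℕ → E →L[𝕜] 𝕜) (x : ℕ → E) : Prop :=
  ∀ y : E, Tendsto (fun n : ℕ => ∑ j ∈ Finset.range n, f j y • x j) atTop (𝓝 y)

/-- `E` admits an atomic decomposition. -/
def AdmitsAtomicDecomposition (𝕜 E : Type*) [RCLike 𝕜] [AddCommGroup E] [Module 𝕜 E]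
    [TopologicalSpace E] : Prop :=
  ∃ (f : ℕ → E →L[𝕜] 𝕜) (x : ℕ → E), IsAtomicDecomposition 𝕜 f x

universe u

/-- The bounded approximation property: the identity of `E` is the pointwise limit of an
equicontinuous net of continuous linear operators of finite rank. Index sets in
`Type u` suffice: a net over any larger index set can be reindexed by pairs of a finite subset of
`E` and a neighbourhood of `0`. -/
def HasBoundedApproximationProperty (𝕜 : Type*) (E : Type u) [RCLike 𝕜] [AddCommGroup E]
    [Module 𝕜 E] [UniformSpace E] : Prop :=
  ∃ (ι : Type u) (_ : Preorder ι) (_ : IsDirectedOrder ι) (_ : Nonempty ι) (T : ι → E →L[𝕜] E),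
    Equicontinuous (fun (i : ι) (y : E) => T i y) ∧
    (∀ i, FiniteDimensional 𝕜 (LinearMap.range (T i : E →ₗ[𝕜] E))) ∧
    ∀ y : E, Tendsto (fun i => T i y) atTop (𝓝 y)

/-! Necessity: the partial-sum operators have finite rank and converge pointwise to the identity, so
Banach–Steinhaus makes them equicontinuous; rational-type combinations of the `x j` give
separability.

Sufficiency follows Pełczyński. Separability turns the net into a sequence of finite rank operators,
and the identity becomes the telescoping sum of their differences `A n`. Each `A n` is split into
rank one terms whose partial sums are at most `2 * q l (A n y)` for `l ≤ n`
(`exists_rankOne_decomposition_partialSum`). Since `A n y` tends to `0`, the blocks can be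
concatenated into one convergent series. -/

/-! ### Rank one splittings controlled by seminorms -/

lemma Seminorm.exists_bound_of_separating {𝕜 V : Type*} [RCLike 𝕜] [AddCommGroup V] [Module 𝕜 V]
    [FiniteDimensional 𝕜 V] (p : Seminorm 𝕜 V) (hp : ∀ v, p v = 0 → v = 0) (g : V →ₗ[𝕜] 𝕜) :
    ∃ C, 0 ≤ C ∧ ∀ v, ‖g v‖ ≤ C * p v := by
  let : Norm V := ⟨p⟩
  have core : NormedSpace.Core 𝕜 V :=
    { norm_nonneg := fun v => apply_nonneg p v
      norm_smul := fun c v => map_smul_eq_mul p c v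
      norm_triangle := fun v w => map_add_le_add p v w
      norm_eq_zero_iff := fun v => ⟨hp v, fun h => by rw [h]; exact map_zero p⟩ }
  let := NormedAddCommGroup.ofCore core
  let := NormedSpace.ofCore core
  exact ⟨‖LinearMap.toContinuousLinearMap g‖, norm_nonneg _,
    fun v => (LinearMap.toContinuousLinearMap g).le_opNorm v⟩

/-- The kernels of the `q l` on `F` decrease with `l`: take `y` in the last nonzero one with index
at most `n`. This copes with seminorms that are not norms on `F`. -/
lemma Submodule.exists_ne_zero_forall_seminorm_eq_zero {𝕜 E : Type*} [RCLike 𝕜] [AddCommGroup E]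
    [Module 𝕜 E] {q : ℕ → Seminorm 𝕜 E} (hq : Monotone q) {F : Submodule 𝕜 E} (hF : F ≠ ⊥)
    (n : ℕ) : ∃ y ∈ F, y ≠ 0 ∧
      ∀ l ≤ n, q l y = 0 ∨ ∀ v ∈ F, q l v = 0 → v = 0 := by
  induction n with
  | zero =>
    by_cases h : ∀ v ∈ F, q 0 v = 0 → v = 0
    · obtain ⟨y, hy, hy0⟩ := F.ne_bot_iff.1 hF
      exact ⟨y, hy, hy0, fun l hl => by obtain rfl := Nat.le_zero.1 hl; exact Or.inr h⟩
    · push Not at h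
      obtain ⟨y, hy, hq0, hy0⟩ := h
      exact ⟨y, hy, hy0, fun l hl => by obtain rfl := Nat.le_zero.1 hl; exact Or.inl hq0⟩
  | succ n ih =>
    by_cases h : ∀ v ∈ F, q (n + 1) v = 0 → v = 0
    · obtain ⟨y, hy, hy0, H⟩ := ih
      refine ⟨y, hy, hy0, fun l hl => ?_⟩
      rcases Nat.le_succ_iff.1 hl with hl | rfl
      · exact H l hl
      · exact Or.inr h
    · push Not at h
      obtain ⟨y, hy, hq0, hy0⟩ := h
      exact ⟨y, hy, hy0, fun l hl =>
        Or.inl (le_antisymm ((hq hl y).trans_eq hq0) (apply_nonneg _ _))⟩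

section PolynormableSpace

variable {𝕜 E : Type*} [RCLike 𝕜] [AddCommGroup E] [Module 𝕜 E]

lemma exists_rankOne_bound [TopologicalSpace E] [IsTopologicalAddGroup E] [ContinuousSMul 𝕜 E]
    [PolynormableSpace 𝕜 E] [T2Space E] {q : ℕ → Seminorm 𝕜 E} (hq : Monotone q)
    {F : Submodule 𝕜 E} [FiniteDimensional 𝕜 F] (hF : F ≠ ⊥) (n : ℕ) :
    ∃ (g : E →L[𝕜] 𝕜) (y : E), y ∈ F ∧ g y = 1 ∧
      ∃ C, 0 ≤ C ∧ ∀ l ≤ n, ∀ v ∈ F, q l (g v • y) ≤ C * q l v := by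
  obtain ⟨y, hy, hy0, H⟩ := F.exists_ne_zero_forall_seminorm_eq_zero hq hF n
  obtain ⟨g₀, hg₀⟩ : ∃ g : F →ₗ[𝕜] 𝕜, g ⟨y, hy⟩ = 1 :=
    Module.Projective.exists_dual_eq_one 𝕜 (by simpa using hy0)
  obtain ⟨g, hg⟩ := StrongDual.exists_extension F (LinearMap.toContinuousLinearMap g₀)
  have hC : ∀ l ≤ n, ∃ C, 0 ≤ C ∧ ∀ v ∈ F, q l (g v • y) ≤ C * q l v := by
    intro l hl
    rcases H l hl with h | h
    · exact ⟨0, le_rfl, fun v _ => by simp [map_smul_eq_mul, h]⟩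
    · obtain ⟨C, hC0, hC⟩ := ((q l).comp F.subtype).exists_bound_of_separating
        (fun v hv => by simpa using h v v.2 hv) g₀
      refine ⟨C * q l y, mul_nonneg hC0 (apply_nonneg _ _), fun v hv => ?_⟩
      have h1 := hC ⟨v, hv⟩
      have h2 : g v = g₀ ⟨v, hv⟩ := hg ⟨v, hv⟩
      rw [map_smul_eq_mul, h2, mul_right_comm]
      exact mul_le_mul_of_nonneg_right h1 (apply_nonneg _ _)
  choose! C hC0 hC using hC
  refine ⟨g, y, hy, (hg ⟨y, hy⟩).trans hg₀, ∑ l ∈ Finset.range (n + 1), C l,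
    Finset.sum_nonneg fun l hl => hC0 l (Finset.mem_range_succ_iff.1 hl), fun l hl v hv =>
    (hC l hl v hv).trans (mul_le_mul_of_nonneg_right ?_ (apply_nonneg _ _))⟩
  exact Finset.single_le_sum (f := C) (fun l hl => hC0 l (Finset.mem_range_succ_iff.1 hl))
    (Finset.mem_range_succ_iff.2 hl)

/-- Induction on the rank: subtracting `g (A x) • y` with `g y = 1` leaves an operator whose range
lies in `ker g`, hence misses `y`. -/
lemma exists_rankOne_decomposition [TopologicalSpace E] [IsTopologicalAddGroup E]
    [ContinuousSMul 𝕜 E] [PolynormableSpace 𝕜 E] [T2Space E] {q : ℕ → Seminorm 𝕜 E}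
    (hq : Monotone q) (n r : ℕ) (A : E →L[𝕜] E)
    [FiniteDimensional 𝕜 (LinearMap.range (A : E →ₗ[𝕜] E))]
    (hr : Module.finrank 𝕜 (LinearMap.range (A : E →ₗ[𝕜] E)) ≤ r) :
    ∃ (N : ℕ) (f : ℕ → E →L[𝕜] 𝕜) (y : ℕ → E) (C : ℝ), 0 ≤ C ∧
      (∀ x, ∑ i ∈ Finset.range N, f i x • y i = A x) ∧
      ∀ i < N, ∀ l ≤ n, ∀ x, q l (f i x • y i) ≤ C * q l (A x) := by
  induction r generalizing A with
  | zero =>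
    have h0 : LinearMap.range (A : E →ₗ[𝕜] E) = ⊥ := Submodule.finrank_eq_zero.1 (by omega)
    refine ⟨0, 0, 0, 0, le_rfl, fun x => ?_, fun i hi => absurd hi (by omega)⟩
    have : A x ∈ LinearMap.range (A : E →ₗ[𝕜] E) := ⟨x, rfl⟩
    simpa [h0, eq_comm] using this
  | succ r ih =>
    by_cases h0 : LinearMap.range (A : E →ₗ[𝕜] E) = ⊥
    · exact ih A (by rw [h0, finrank_bot]; exact Nat.zero_le r)
    obtain ⟨g, y, ⟨x₀, hx₀⟩, hgy, C, hC0, hC⟩ := exists_rankOne_bound hq h0 n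
    let A' : E →L[𝕜] E := A - (g.comp A).smulRight y
    have hA' : ∀ x, A' x = A x - g (A x) • y := fun x => rfl
    have hle : LinearMap.range (A' : E →ₗ[𝕜] E) ≤ LinearMap.range (A : E →ₗ[𝕜] E) := by
      rintro _ ⟨x, rfl⟩
      exact ⟨x - g (A x) • x₀, by simp [hA', ← hx₀]⟩
    have hlt : LinearMap.range (A' : E →ₗ[𝕜] E) < LinearMap.range (A : E →ₗ[𝕜] E) := by
      refine lt_of_le_of_ne hle fun h => ?_
      obtain ⟨x, hx⟩ := h.ge ⟨x₀, hx₀⟩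
      have hx : A' x = y := hx
      have : g (A' x) = 0 := by simp [hA', hgy]
      rw [hx, hgy] at this
      exact one_ne_zero this
    have : FiniteDimensional 𝕜 (LinearMap.range (A' : E →ₗ[𝕜] E)) :=
      Submodule.finiteDimensional_of_le hle
    obtain ⟨N, f, z, D, hD0, hsum, hD⟩ := ih A' (by
      have := Submodule.finrank_lt_finrank_of_lt hlt
      omega)
    have hCA : ∀ l ≤ n, ∀ x, q l (g (A x) • y) ≤ C * q l (A x) :=
      fun l hl x => hC l hl _ ⟨x, rfl⟩
    refine ⟨N + 1, fun i => Nat.casesOn i (g.comp A) f, fun i => Nat.casesOn i y z,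
      C + D * (1 + C), by positivity, fun x => ?_, fun i hi l hl x => ?_⟩
    · rw [Finset.sum_range_succ']
      change ∑ i ∈ Finset.range N, f i x • z i + g (A x) • y = A x
      rw [hsum, hA', sub_add_cancel]
    · have hq0 : 0 ≤ q l (A x) := apply_nonneg _ _
      rcases i with _ | i
      · refine (hCA l hl x).trans (mul_le_mul_of_nonneg_right ?_ hq0)
        have : 0 ≤ D * (1 + C) := by positivity
        linarith
      · have h1 : q l (f i x • z i) ≤ D * q l (A' x) := hD i (by omega) l hl x
        have h2 : q l (A' x) ≤ (1 + C) * q l (A x) := by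
          rw [hA', add_mul, one_mul]
          exact (map_sub_le_add _ _ _).trans (by linarith [hCA l hl x])
        change q l (f i x • z i) ≤ _
        have h3 := mul_le_mul_of_nonneg_left h2 hD0
        have h4 := mul_nonneg hC0 hq0
        nlinarith

/-- A finite rank operator `A` is a finite sum of operators of rank one all of whose partial sums
are bounded by `A` with respect to finitely many given seminorms. -/
lemma exists_rankOne_decomposition_partialSum [TopologicalSpace E] [IsTopologicalAddGroup E]
    [ContinuousSMul 𝕜 E] [PolynormableSpace 𝕜 E] [T2Space E] {q : ℕ → Seminorm 𝕜 E}
    (hq : Monotone q) (n : ℕ) (A : E →L[𝕜] E)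
    [FiniteDimensional 𝕜 (LinearMap.range (A : E →ₗ[𝕜] E))] :
    ∃ (N : ℕ) (f : ℕ → E →L[𝕜] 𝕜) (y : ℕ → E), 0 < N ∧
      (∀ x, ∑ i ∈ Finset.range N, f i x • y i = A x) ∧
      ∀ k ≤ N, ∀ l ≤ n, ∀ x, q l (∑ i ∈ Finset.range k, f i x • y i) ≤ 2 * q l (A x) := by
  obtain ⟨N₀, f, y, C, hC0, hsum, hC⟩ := exists_rankOne_decomposition hq n _ A le_rfl
  -- Run through the `N₀` terms `M + 1` times with weight `1 / (M + 1)`. Complete cycles contribute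
  -- at most `q l (A x)`; an unfinished one at most `N₀ * C / (M + 1)` times that, hence the factor
  -- 2.
  obtain ⟨M, hM⟩ := exists_nat_ge (N₀ * C)
  rcases Nat.eq_zero_or_pos N₀ with rfl | hN
  · have hA : ∀ x, A x = 0 := fun x => by simpa using (hsum x).symm
    exact ⟨1, 0, 0, one_pos, fun x => by simp [hA], fun k _ l _ x => by simp [hA]⟩
  have hM0 : (0 : ℝ) < (M + 1 : ℕ) := by positivity
  have hMk : ((M + 1 : ℕ) : 𝕜) ≠ 0 := Nat.cast_ne_zero.2 (Nat.succ_ne_zero M)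
  have key : ∀ x k, ∑ i ∈ Finset.range k, (((M + 1 : ℕ) : 𝕜)⁻¹ • f (i % N₀)) x • y (i % N₀) =
      ((M + 1 : ℕ) : 𝕜)⁻¹ • (((k / N₀ : ℕ) : 𝕜) • A x +
        ∑ i ∈ Finset.range (k % N₀), f i x • y i) := by
    intro x k
    simp only [_root_.smul_apply, smul_assoc, ← Finset.smul_sum]
    congr 1
    induction k with
    | zero => simp
    | succ k ih =>
      rw [Finset.sum_range_succ, ih, add_assoc, ← Finset.sum_range_succ (fun i => f i x • y i)]
      rcases (Nat.succ_le_of_lt (Nat.mod_lt k hN)).lt_or_eq with h | h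
      · have h1 : (k + 1) % N₀ = k % N₀ + 1 := by
          rw [Nat.add_mod_eq_ite]
          have : 1 % N₀ = 1 := Nat.mod_eq_of_lt (by omega)
          simp only [this]
          rw [if_neg (by omega)]
        have h2 : (k + 1) / N₀ = k / N₀ := by
          rw [Nat.succ_div, if_neg (fun hd => by have := Nat.mod_eq_zero_of_dvd hd; omega),
            add_zero]
        rw [h1, h2]
      · have hd : N₀ ∣ k + 1 := by
          refine ⟨k / N₀ + 1, ?_⟩
          have := Nat.div_add_mod k N₀
          rw [mul_add]
          omega
        have h1 : (k + 1) % N₀ = 0 := Nat.mod_eq_zero_of_dvd hd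
        have h2 : (k + 1) / N₀ = k / N₀ + 1 := by rw [Nat.succ_div, if_pos hd]
        have h3 : k % N₀ + 1 = N₀ := h
        rw [h1, h2, h3, hsum]
        simp [add_smul]
  refine ⟨(M + 1) * N₀, fun i => ((M + 1 : ℕ) : 𝕜)⁻¹ • f (i % N₀), fun i => y (i % N₀),
    by positivity, fun x => ?_, fun k hk l hl x => ?_⟩
  · rw [key, Nat.mul_div_cancel _ hN, Nat.mul_mod_left]
    rw [Finset.sum_range_zero, add_zero, smul_smul, inv_mul_cancel₀ hMk, one_smul]
  · rw [key, map_smul_eq_mul, norm_inv, RCLike.norm_natCast, inv_mul_le_iff₀ hM0]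
    have hq0 : 0 ≤ q l (A x) := apply_nonneg _ _
    have hdiv : ((k / N₀ : ℕ) : ℝ) ≤ (M + 1 : ℕ) :=
      Nat.cast_le.2 (Nat.div_le_of_le_mul (by rwa [mul_comm]))
    have h1 : q l (((k / N₀ : ℕ) : 𝕜) • A x) ≤ (M + 1 : ℕ) * q l (A x) := by
      rw [map_smul_eq_mul, RCLike.norm_natCast]
      exact mul_le_mul_of_nonneg_right hdiv hq0
    have h2 : q l (∑ i ∈ Finset.range (k % N₀), f i x • y i) ≤ (M + 1 : ℕ) * q l (A x) := by
      have hkN := Nat.mod_lt k hN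
      calc q l (∑ i ∈ Finset.range (k % N₀), f i x • y i)
          ≤ ∑ i ∈ Finset.range (k % N₀), q l (f i x • y i) :=
            Finset.le_sum_of_subadditive _ (map_zero _).le (map_add_le_add _) _ _
        _ ≤ ∑ i ∈ Finset.range (k % N₀), C * q l (A x) := Finset.sum_le_sum fun i hi =>
            hC i ((Finset.mem_range.1 hi).trans hkN) l hl x
        _ = (k % N₀ : ℕ) * C * q l (A x) := by simp [mul_assoc]
        _ ≤ (M + 1 : ℕ) * q l (A x) := by
            refine mul_le_mul_of_nonneg_right ?_ hq0
            have : ((k % N₀ : ℕ) : ℝ) * C ≤ N₀ * C :=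
              mul_le_mul_of_nonneg_right (Nat.cast_le.2 hkN.le) hC0
            push_cast
            linarith
    exact (map_add_le_add _ _ _).trans (by linarith)

end PolynormableSpace

/-! ### Concatenation of finite blocks -/

lemma exists_concatenation {d : ℕ → ℕ} (hd : ∀ n, 0 < d n) :
    ∃ s : ℕ → ℕ × ℕ, (∀ m, (s m).2 < d (s m).1) ∧ Tendsto (fun m => (s m).1) atTop atTop ∧
      ∀ {G : Type*} [AddCommGroup G] (a : ℕ → ℕ → G) (m : ℕ),
        ∑ j ∈ Finset.range m, a (s j).1 (s j).2 =
          ∑ n ∈ Finset.range (s m).1, ∑ k ∈ Finset.range (d n), a n k +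
            ∑ k ∈ Finset.range (s m).2, a (s m).1 k := by
  -- A state is (block, position in the block) of the next term to be summed.
  let next : ℕ × ℕ → ℕ × ℕ := fun t => if t.2 + 1 < d t.1 then (t.1, t.2 + 1) else (t.1 + 1, 0)
  let s : ℕ → ℕ × ℕ := fun m => next^[m] (0, 0)
  have hs : ∀ m, s (m + 1) = next (s m) := fun m => Function.iterate_succ_apply' _ _ _
  have hlt : ∀ m, (s m).2 < d (s m).1 := by
    intro m
    induction m with
    | zero => exact hd 0
    | succ m ih =>
      rw [hs]
      by_cases h : (s m).2 + 1 < d (s m).1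
      · simp [next, h]
      · simpa [next, h] using hd _
  have hmono : Monotone fun m => (s m).1 := monotone_nat_of_le_succ fun m => by
    rw [hs]
    by_cases h : (s m).2 + 1 < d (s m).1 <;> simp [next, h]
  refine ⟨s, hlt, tendsto_atTop_atTop_of_monotone hmono ?_, fun a m => ?_⟩
  · have hex : ∀ n, ∃ m, s m = (n, 0) := by
      intro n
      induction n with
      | zero => exact ⟨0, rfl⟩
      | succ n ih =>
        obtain ⟨m, hm⟩ := ih
        have hrun : ∀ k < d n, s (m + k) = (n, k) := by
          intro k
          induction k with
          | zero => exact fun _ => hm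
          | succ k ihk =>
            intro hk
            rw [← add_assoc, hs, ihk (by omega)]
            simp [next, hk]
        have hdn := hd n
        refine ⟨m + (d n - 1) + 1, ?_⟩
        rw [hs, hrun _ (by omega)]
        exact if_neg (by simp only; omega)
    intro n
    obtain ⟨m, hm⟩ := hex n
    exact ⟨m, by simp [hm]⟩
  · induction m with
    | zero => simp [s]
    | succ m ih =>
      rw [Finset.sum_range_succ, ih, add_assoc,
        ← Finset.sum_range_succ (fun k => a (s m).1 k), hs]
      by_cases h : (s m).2 + 1 < d (s m).1
      · simp [next, h]
      · have h' : (s m).2 + 1 = d (s m).1 := by have := hlt m; omega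
        have h'' : next (s m) = ((s m).1 + 1, 0) := if_neg h
        rw [h'', h', Finset.sum_range_zero, add_zero, Finset.sum_range_succ]


/-! ### The two implications -/

section MainTheorem

variable {𝕜 E : Type*} [RCLike 𝕜] [AddCommGroup E] [Module 𝕜 E]

lemma exists_monotone_seminorm_basis [TopologicalSpace E] [IsTopologicalAddGroup E]
    [PolynormableSpace 𝕜 E] [FirstCountableTopology E] :
    ∃ q : ℕ → Seminorm 𝕜 E, Monotone q ∧ (∀ n, Continuous (q n)) ∧
      ∀ U ∈ 𝓝 (0 : E), ∃ n, ∃ r > 0, (q n).ball 0 r ⊆ U := by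
  obtain ⟨U, hU⟩ := (𝓝 (0 : E)).exists_antitone_basis
  have hp := PolynormableSpace.withSeminorms 𝕜 E
  choose s r hr hs using fun n => (hp.mem_nhds_iff 0 (U n)).1 (hU.mem n)
  have hsup : ∀ t : Finset {p : Seminorm 𝕜 E // Continuous p},
      Continuous (t.sup (fun p => p.1) : Seminorm 𝕜 E) := by
    refine fun t => Finset.sup_induction (p := fun p : Seminorm 𝕜 E => Continuous p) ?_ ?_ ?_
    · exact continuous_const
    · exact fun p₁ h₁ p₂ h₂ => h₁.max h₂
    · exact fun p _ => p.2
  refine ⟨partialSups fun n => (s n).sup fun p => p.1, (partialSups _).monotone, fun n => ?_,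
    fun V hV => ?_⟩
  · induction n with
    | zero => simpa using hsup _
    | succ n ih =>
      rw [partialSups_add_one]
      exact ih.max (hsup _)
  · obtain ⟨n, hn⟩ := hU.mem_iff.1 hV
    exact ⟨n, r n, hr n, fun y hy => hn (hs n (Seminorm.ball_antitone
      (le_partialSups (fun n => (s n).sup fun p => p.1) n) hy))⟩

lemma tendsto_nhds_of_seminorm_basis [TopologicalSpace E] [IsTopologicalAddGroup E]
    {q : ℕ → Seminorm 𝕜 E} (hq : ∀ U ∈ 𝓝 (0 : E), ∃ n, ∃ r > 0, (q n).ball 0 r ⊆ U)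
    {ι : Type*} {l : Filter ι} {u : ι → E} {y : E}
    (h : ∀ n, Tendsto (fun i => q n (u i - y)) l (𝓝 0)) : Tendsto u l (𝓝 y) := by
  rw [← tendsto_sub_nhds_zero_iff]
  intro U hU
  obtain ⟨n, r, hr, hn⟩ := hq U hU
  filter_upwards [(h n).eventually_lt_const hr] with i hi
  exact hn (by simpa [Seminorm.mem_ball] using hi)

lemma Seminorm.tendsto_sub_zero [TopologicalSpace E] [IsTopologicalAddGroup E]
    {q : Seminorm 𝕜 E} (hq : Continuous q) {ι : Type*} {l : Filter ι} {u : ι → E} {y : E}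
    (h : Tendsto u l (𝓝 y)) : Tendsto (fun i => q (u i - y)) l (𝓝 0) := by
  have := (hq.tendsto _).comp (tendsto_sub_nhds_zero_iff.2 h)
  rwa [map_zero] at this

/-- On a separable Fréchet space with the bounded approximation property, the identity is the
pointwise limit of a sequence of operators of finite rank. -/
lemma HasBoundedApproximationProperty.exists_seq [UniformSpace E] [IsUniformAddGroup E]
    [ContinuousSMul 𝕜 E] [PolynormableSpace 𝕜 E] [FirstCountableTopology E]
    [TopologicalSpace.SeparableSpace E] (h : HasBoundedApproximationProperty 𝕜 E) :
    ∃ T : ℕ → E →L[𝕜] E,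
      (∀ n, FiniteDimensional 𝕜 (LinearMap.range (T n : E →ₗ[𝕜] E))) ∧
      ∀ y, Tendsto (fun n => T n y) atTop (𝓝 y) := by
  obtain ⟨ι, _, _, _, T, hequi, hfin, hT⟩ := h
  obtain ⟨q, hmono, hcont, hbasis⟩ := exists_monotone_seminorm_basis (𝕜 := 𝕜) (E := E)
  have hd := TopologicalSpace.denseRange_denseSeq E
  let d := TopologicalSpace.denseSeq E
  -- Only finitely many conditions at each stage, so one index of the net meets them all.
  have hex : ∀ n : ℕ, ∃ i, ∀ j ≤ n, q n (T i (d j) - d j) < 1 / ((n : ℝ) + 1) := fun n =>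
    ((Set.finite_Iic n).eventually_all.2 fun j _ => (Seminorm.tendsto_sub_zero (hcont n)
      (hT (d j))).eventually_lt_const (by positivity)).exists
  choose i hi using hex
  refine ⟨fun n => T (i n), fun n => hfin (i n), fun y => ?_⟩
  -- By equicontinuity the points of convergence form a closed set; it remains to treat the dense
  -- sequence.
  have hclosed := (hequi.comp i).isClosed_setOfPred_tendsto (l := atTop) continuous_id
  refine hclosed.closure_subset_iff.2 ?_ (hd y)
  rintro _ ⟨j, rfl⟩
  refine tendsto_nhds_of_seminorm_basis hbasis fun l => ?_
  refine squeeze_zero' (Eventually.of_forall fun n => apply_nonneg _ _) ?_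
    tendsto_one_div_add_atTop_nhds_zero_nat
  filter_upwards [eventually_ge_atTop l, eventually_ge_atTop j] with n hl hj
  exact (hmono hl _).trans (hi n j hj).le

lemma HasBoundedApproximationProperty.admitsAtomicDecomposition [UniformSpace E]
    [IsUniformAddGroup E] [ContinuousSMul 𝕜 E] [PolynormableSpace 𝕜 E] [T2Space E]
    [FirstCountableTopology E] [TopologicalSpace.SeparableSpace E]
    (h : HasBoundedApproximationProperty 𝕜 E) : AdmitsAtomicDecomposition 𝕜 E := by
  obtain ⟨T, hfin, hT⟩ := h.exists_seq
  obtain ⟨q, hmono, hcont, hbasis⟩ := exists_monotone_seminorm_basis (𝕜 := 𝕜) (E := E)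
  -- Starting from `0` makes the differences telescope to `S n` itself.
  obtain ⟨S, hS0, hST⟩ : ∃ S : ℕ → E →L[𝕜] E, S 0 = 0 ∧ ∀ n, S (n + 1) = T n :=
    ⟨fun n => Nat.casesOn n 0 T, rfl, fun n => rfl⟩
  have hS : ∀ y, Tendsto (fun n => S n y) atTop (𝓝 y) := fun y =>
    (tendsto_add_atTop_iff_nat 1).1 (by simpa only [hST] using hT y)
  have hSfin : ∀ n : ℕ, FiniteDimensional 𝕜 (LinearMap.range (S n : E →ₗ[𝕜] E)) := by
    rintro (_ | n)
    · rw [hS0]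
      rw [ContinuousLinearMap.toLinearMap_zero, LinearMap.range_zero]
      infer_instance
    · rw [hST]
      exact hfin n
  have hA : ∀ n, FiniteDimensional 𝕜
      (LinearMap.range ((S (n + 1) - S n : E →L[𝕜] E) : E →ₗ[𝕜] E)) := by
    intro n
    have := hSfin n
    have := hSfin (n + 1)
    refine Submodule.finiteDimensional_of_le (S₂ := LinearMap.range (S (n + 1) : E →ₗ[𝕜] E) ⊔
      LinearMap.range (S n : E →ₗ[𝕜] E)) ?_
    rintro _ ⟨x, rfl⟩
    exact Submodule.sub_mem_sup ⟨x, rfl⟩ ⟨x, rfl⟩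
  choose N f x hN hsum hbound using fun n =>
    exists_rankOne_decomposition_partialSum hmono n (S (n + 1) - S n)
  obtain ⟨s, hs, hlim, hconcat⟩ := exists_concatenation hN
  refine ⟨fun j => f (s j).1 (s j).2, fun j => x (s j).1 (s j).2, fun y => ?_⟩
  have htel : ∀ n, ∑ k ∈ Finset.range n, (S (k + 1) - S k) y = S n y := fun n => by
    simpa [hS0] using Finset.sum_range_sub (fun k => S k y) n
  have hpartial : ∀ m, ∑ j ∈ Finset.range m, f (s j).1 (s j).2 y • x (s j).1 (s j).2 =
      S (s m).1 y + ∑ k ∈ Finset.range (s m).2, f (s m).1 k y • x (s m).1 k := fun m => by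
    rw [hconcat fun n k => f n k y • x n k]
    simp only [hsum, htel]
  simp only [hpartial]
  refine tendsto_nhds_of_seminorm_basis hbasis fun l => ?_
  have hdiff : Tendsto (fun n => (S (n + 1) - S n) y) atTop (𝓝 0) := by
    simpa using ((tendsto_add_atTop_iff_nat 1).2 (hS y)).sub (hS y)
  have hlimit : Tendsto (fun n => q l (S n y - y) + 2 * q l ((S (n + 1) - S n) y - 0)) atTop
      (𝓝 0) := by
    simpa using (Seminorm.tendsto_sub_zero (hcont l) (hS y)).add
      ((Seminorm.tendsto_sub_zero (hcont l) hdiff).const_mul 2)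
  refine squeeze_zero' (Eventually.of_forall fun m => apply_nonneg _ _) ?_ (hlimit.comp hlim)
  -- Block `n` is controlled only for seminorms of index at most `n`, so the estimate for `q l`
  -- starts at block `l`.
  filter_upwards [hlim.eventually_ge_atTop l] with m hm
  rw [add_sub_right_comm]
  refine (map_add_le_add _ _ _).trans (add_le_add le_rfl ?_)
  rw [sub_zero]
  exact hbound _ _ (hs m).le l hm y

lemma IsAtomicDecomposition.separableSpace [TopologicalSpace E] [IsTopologicalAddGroup E]
    [ContinuousSMul 𝕜 E] {f : ℕ → E →L[𝕜] 𝕜} {x : ℕ → E} (h : IsAtomicDecomposition 𝕜 f x) :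
    TopologicalSpace.SeparableSpace E := by
  have hsep : TopologicalSpace.IsSeparable (closure (Submodule.span 𝕜 (Set.range x) : Set E)) :=
    (Set.countable_range x).isSeparable.span.closure
  refine TopologicalSpace.isSeparable_univ_iff.1 (hsep.mono fun y _ => ?_)
  exact mem_closure_of_tendsto (h y) (Eventually.of_forall fun n => Submodule.sum_mem _ fun j _ =>
    Submodule.smul_mem _ _ (Submodule.subset_span ⟨j, rfl⟩))

end MainTheorem

lemma IsAtomicDecomposition.hasBoundedApproximationProperty {𝕜 : Type*} {E : Type u} [RCLike 𝕜]
    [AddCommGroup E] [Module 𝕜 E] [UniformSpace E] [IsUniformAddGroup E] [ContinuousSMul 𝕜 E]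
    [PolynormableSpace 𝕜 E] [BarrelledSpace 𝕜 E] {f : ℕ → E →L[𝕜] 𝕜} {x : ℕ → E}
    (h : IsAtomicDecomposition 𝕜 f x) : HasBoundedApproximationProperty 𝕜 E := by
  let T : ℕ → E →L[𝕜] E := fun n => ∑ j ∈ Finset.range n, (f j).smulRight (x j)
  have hT : ∀ n y, T n y = ∑ j ∈ Finset.range n, f j y • x j := fun n y => by simp [T]
  have hlim : ∀ y, Tendsto (fun n => T n y) atTop (𝓝 y) := fun y => by
    simpa only [hT] using h y
  have hequi : Equicontinuous fun n y => T n y :=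
    (PolynormableSpace.banach_steinhaus (𝓕 := T) fun y =>
      (hlim y).isVonNBounded_range 𝕜).equicontinuous
  -- The sequence is lifted to a net indexed in the universe of `E`.
  refine ⟨ULift.{u} ℕ, inferInstance, ⟨fun a b => ⟨⟨max a.down b.down⟩, ?_, ?_⟩⟩, inferInstance,
    fun n => T n.down, hequi.comp ULift.down, fun n => ?_, fun y => ?_⟩
  · exact le_max_left a.down b.down
  · exact le_max_right a.down b.down
  · have := FiniteDimensional.span_of_finite 𝕜 (Set.finite_Iio n.down |>.image x)
    refine Submodule.finiteDimensional_of_le (S₂ := Submodule.span 𝕜 (x '' Set.Iio n.down)) ?_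
    rintro _ ⟨y, rfl⟩
    change T n.down y ∈ _
    rw [hT]
    exact Submodule.sum_mem _ fun j hj => Submodule.smul_mem _ _
      (Submodule.subset_span ⟨j, Finset.mem_range.1 hj, rfl⟩)
  · refine (hlim y).comp (tendsto_atTop_atTop.2 fun b => ⟨⟨b⟩, fun a ha => ha⟩)

theorem mainTheorem10 {𝕜 : Type*} {E : Type*} [RCLike 𝕜] [AddCommGroup E] [Module 𝕜 E]
    [UniformSpace E] [IsUniformAddGroup E] [ContinuousSMul 𝕜 E]
    [PolynormableSpace 𝕜 E] [TopologicalSpace.MetrizableSpace E] [CompleteSpace E] :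
    AdmitsAtomicDecomposition 𝕜 E ↔
      TopologicalSpace.SeparableSpace E ∧ HasBoundedApproximationProperty 𝕜 E := by
  constructor
  · rintro ⟨f, x, h⟩
    -- With completeness this makes `E` a Baire space, hence barrelled, as Banach–Steinhaus
    -- requires.
    have := IsUniformAddGroup.uniformity_countably_generated (α := E)
    exact ⟨h.separableSpace, h.hasBoundedApproximationProperty⟩
  · rintro ⟨_, h⟩
    exact h.admitsAtomicDecomposition
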